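/- **Schauder's fixed point theorem (infinite-dimensional case).** Let $G$ be a real normed space (not assumed complete) and let $X \subseteq G$ be a compact convex set that is infinite-dimensional, meaning that the linear subspace spanned by the differences $x-y$ with $x,y\in X$ (equivalently, the affine hull of $X$) is infinite-dimensional. Then $X$ has the fixed point property: every continuous map $f : X \to X$ has a point $x \in X$ with $f(x) = x$. -/

import Mathlib

/-!
A compact convex set `X` in a normed space can be projected, with an error below any `ε > 0`, onto
the convex hull of a finite `ε`-net, and the projection factors continuously through a standard
simplex (`exists_schauder_projection`). Brouwer's theorem on that simplex
(`exists_fixedPoint_stdSimplex`) therefore yields a point of `X` moved by less than `ε`,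
and compactness gives a fixed point (`exists_eq_of_forall_exists_dist_lt`). The dimension hypothesis
enters only through the fact that an infinite-dimensional set is nonempty.

Brouwer's theorem is derived from Scarf's lemma (`exists_finset_dominant_image`), a
triangulation-free counterpart of Sperner's lemma. Given rankings `h i` of a finite set `T` by an
index set `I` and a colouring of `T` by `I`, it finds `σ ⊆ T` such that no point of `T` exceeds all
of `σ` strictly in every ranking whose index is a colour of `σ`. Take `T` to be the grid of points
with denominator `N` in the simplex, ranked by coordinates, with `x` coloured by some `i` such that
`x i ≤ f x i`. Dominance forces `σ` to have small diameter and small coordinates at the colours it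
misses (`exists_grid_finset`), so `f` nearly increases every coordinate at the points of `σ`; as
coordinates sum to one, `f` nearly fixes them (`exists_dist_lt_stdSimplex`).

Scarf's lemma is a parity argument. After adjoining to `T` one auxiliary vertex for each `i ∈ I`,
a dominant set with `card I - 1` elements that carries all colours but a fixed one extends to a
dominant set with `card I` elements in exactly two ways (`Dominant.card_insert_eq_two`), apart from
a single boundary set that extends in one way. On the other side, a dominant set with `card I` elements that misses some colour contains
an even number of sets carrying all colours but a fixed one (`even_card_erase_of_image_ne_univ`).
Counting incidences modulo two produces a dominant set with all colours
(`exists_dominant_image_eq_univ`).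
-/

/-! ### Scarf's lemma -/

section Scarf

variable {V I α : Type*} [LinearOrder α]

/-- A finite set `S` is dominant for the family of rankings `r i : V → α` if no `y` strictly
exceeds, for every `i`, the `r i`-minimum of `S`. -/
def Dominant (r : I → V → α) (S : Finset V) : Prop :=
  ∀ y, ∃ i, ∀ x ∈ S, r i y ≤ r i x

lemma Dominant.mono {r : I → V → α} {S S' : Finset V} (h : Dominant r S') (hS : S ⊆ S') :
    Dominant r S := fun y ↦ (h y).imp fun _ hi x hx ↦ hi x (hS hx)

/-- The points lying above the `r i`-minimum `m i` of a set for every `i ≠ k`. A point that replaces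
the `r k`-minimum of the set while keeping the other minima has to be taken from here. -/
def aboveExcept (r : I → V → α) (m : I → V) (k : I) : Set V :=
  {y | ∀ i ≠ k, r i (m i) < r i y}

lemma mem_aboveExcept {r : I → V → α} {m : I → V} {k : I} {y : V} :
    y ∈ aboveExcept r m k ↔ ∀ i ≠ k, r i (m i) < r i y := Iff.rfl

variable [DecidableEq V]

/-- Let `D` be dominant with `r i`-minima `m i`, and let every point of `D` be `m i` for some `i ≠ k`.
Adding the `r k`-largest point of `aboveExcept r m k` keeps `D` dominant. -/
lemma Dominant.insert_of_isMax {r : I → V → α} {D : Finset V} (hD : Dominant r D) {m : I → V}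
    (hm : ∀ i, m i ∈ D ∧ ∀ x ∈ D, r i (m i) ≤ r i x) {k : I}
    (hsurj : ∀ x ∈ D, ∃ i ≠ k, m i = x) {w : V} (hw : w ∈ aboveExcept r m k)
    (hmax : ∀ y ∈ aboveExcept r m k, r k y ≤ r k w) :
    w ∉ D ∧ Dominant r (insert w D) := by
  rw [mem_aboveExcept] at hw
  refine ⟨fun hwD ↦ ?_, fun y ↦ ?_⟩
  · obtain ⟨i, hik, rfl⟩ := hsurj w hwD
    exact lt_irrefl _ (hw i hik)
  · by_cases hy : y ∈ aboveExcept r m k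
    · refine ⟨k, (Finset.forall_mem_insert _ _ _).2 ⟨hmax y hy, ?_⟩⟩
      obtain ⟨i, hi⟩ := hD y
      rcases eq_or_ne i k with rfl | hik
      · exact hi
      · exact absurd (hi _ (hm i).1) (not_le.2 (mem_aboveExcept.1 hy i hik))
    · rw [mem_aboveExcept] at hy
      push Not at hy
      obtain ⟨i, hik, hi⟩ := hy
      exact ⟨i, (Finset.forall_mem_insert _ _ _).2
        ⟨hi.trans (hw i hik).le, fun x hx ↦ hi.trans ((hm i).2 x hx)⟩⟩

/-- Conversely, if adding `w` to a set containing all `m i` gives a dominant set, then `w` is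
`r k`-above every point of `aboveExcept r m k`. -/
lemma Dominant.isMax_of_insert {r : I → V → α} {D : Finset V} {m : I → V}
    (hm : ∀ i, m i ∈ D) {k : I} {w : V} (h : Dominant r (insert w D)) :
    ∀ y ∈ aboveExcept r m k, r k y ≤ r k w := by
  intro y hy
  obtain ⟨i, hi⟩ := h y
  rcases eq_or_ne i k with rfl | hik
  · exact hi w (Finset.mem_insert_self _ _)
  · exact absurd (hi _ (Finset.mem_insert_of_mem (hm i)))
      (not_le.2 (mem_aboveExcept.1 hy i hik))

variable [Fintype I] [DecidableEq I]

/-- A set as large as the set of colours which misses some colour has an even number of points whose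
removal leaves exactly the colours other than `i₀`. -/
lemma even_card_erase_of_image_ne_univ {c : V → I} {R : Finset V}
    (hcard : R.card = Fintype.card I) (hR : R.image c ≠ Finset.univ) (i₀ : I) :
    Even (R.filter fun x ↦ (R.erase x).image c = Finset.univ.erase i₀).card := by
  rcases Finset.eq_empty_or_nonempty
    (R.filter fun x ↦ (R.erase x).image c = Finset.univ.erase i₀) with h | ⟨x, hx⟩
  · simp [h]
  obtain ⟨hxR, hx⟩ := Finset.mem_filter.1 hx
  have hinj : Set.InjOn c (R.erase x : Finset V) := by
    rw [← Finset.card_image_iff, hx, Finset.card_erase_of_mem (Finset.mem_univ _),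
      Finset.card_erase_of_mem hxR, Finset.card_univ, hcard]
  have hcx : c x ≠ i₀ := by
    rintro rfl
    apply hR
    rw [← Finset.insert_erase hxR, Finset.image_insert, hx, Finset.insert_erase (Finset.mem_univ _)]
  obtain ⟨x', hx', hcx'⟩ : ∃ x' ∈ R.erase x, c x' = c x := by
    rw [← Finset.mem_image, hx]
    simpa using hcx
  obtain ⟨hxx', hx'R⟩ := Finset.mem_erase.1 hx'
  suffices h : (R.filter fun x ↦ (R.erase x).image c = Finset.univ.erase i₀) = {x, x'} by
    rw [h, Finset.card_pair hxx'.symm]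
    exact even_two
  ext y
  simp only [Finset.mem_filter, Finset.mem_insert, Finset.mem_singleton]
  constructor
  · rintro ⟨hyR, hy⟩
    by_contra! hne
    have hyx : y ∈ R.erase x := Finset.mem_erase.2 ⟨hne.1, hyR⟩
    obtain ⟨y', hy', hcy⟩ : ∃ y' ∈ R.erase y, c y' = c y := by
      rw [← Finset.mem_image, hy, ← hx]
      exact Finset.mem_image_of_mem c hyx
    obtain ⟨hyy', hy'R⟩ := Finset.mem_erase.1 hy'
    by_cases hy'x : y' = x
    · subst hy'x
      exact hne.2 (hinj hyx hx' (hcy.symm.trans hcx'.symm))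
    · exact hyy' (hinj (Finset.mem_coe.2 (Finset.mem_erase.2 ⟨hy'x, hy'R⟩)) hyx hcy)
  · rintro (rfl | rfl)
    · exact ⟨hxR, hx⟩
    · refine ⟨hx'R, ?_⟩
      rw [← hx, ← Finset.insert_erase (Finset.mem_erase.2 ⟨hxx'.symm, hxR⟩),
        ← Finset.insert_erase hx', Finset.image_insert, Finset.image_insert, hcx',
        Finset.erase_right_comm]

variable [Finite V]

/-- The replacement step: the minima of a dominant set with one element fewer than there are rankings
coincide for exactly two rankings `j` and `k`, and a point can be added keeping dominance
exactly by replacing the minimum for `j` or the minimum for `k`. -/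
lemma Dominant.card_insert_eq_two [Nontrivial I] {r : I → V → α}
    (hr : ∀ i, Function.Injective (r i)) {D : Finset V} (hD : Dominant r D)
    (hcard : D.card + 1 = Fintype.card I)
    (hne : ∀ m : I → V, (∀ i, m i ∈ D ∧ ∀ x ∈ D, r i (m i) ≤ r i x) →
      ∀ k, (aboveExcept r m k).Nonempty) :
    ({w | w ∉ D ∧ Dominant r (insert w D)} : Set V).ncard = 2 := by
  have hDne : D.Nonempty := by
    have := Fintype.one_lt_card (α := I)
    exact Finset.card_pos.1 (by omega)
  choose m hm using fun i ↦ D.exists_min_image (r i) hDne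
  have hmem (i) : m i ∈ D := (hm i).1
  have heq {i x} (hx : x ∈ D) (h : ∀ x' ∈ D, r i x ≤ r i x') : m i = x :=
    hr i (le_antisymm ((hm i).2 x hx) (h _ (hmem i)))
  have hsurj : ∀ x ∈ D, ∃ i, m i = x := fun x hx ↦ (hD x).imp fun i hi ↦ heq hx hi
  obtain ⟨j, k, hjk, hmjk⟩ : ∃ j k, j ≠ k ∧ m j = m k := by
    obtain ⟨j, -, k, -, h, h'⟩ := Finset.exists_ne_map_eq_of_card_lt_of_maps_to
      (s := Finset.univ) (t := D) (f := m) (by simp; omega) (fun i _ ↦ hmem i)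
    exact ⟨j, k, h, h'⟩
  have hsurj' {a b : I} (hab : a ≠ b) (h : m a = m b) : ∀ x ∈ D, ∃ i ≠ b, m i = x := by
    intro x hx
    obtain ⟨i, rfl⟩ := hsurj x hx
    by_cases hib : i = b
    · exact ⟨a, hab, hib ▸ h⟩
    · exact ⟨i, hib, rfl⟩
  -- By counting, `m` is injective away from either of the two coinciding indices.
  have hinj {a b : I} (hab : a ≠ b) (h : m a = m b) {i i' : I} (hi : i ≠ b) (hi' : i' ≠ b)
      (hii : m i = m i') : i = i' := by
    have himg : (Finset.univ.erase b).image m = D := by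
      ext x
      simp only [Finset.mem_image, Finset.mem_erase, Finset.mem_univ, and_true]
      exact ⟨by rintro ⟨i, -, rfl⟩; exact hmem i, fun hx ↦ hsurj' hab h x hx⟩
    have : Set.InjOn m (Finset.univ.erase b : Finset I) := by
      rw [← Finset.card_image_iff, himg, Finset.card_erase_of_mem (Finset.mem_univ _),
        Finset.card_univ]
      omega
    exact this (by simpa using hi) (by simpa using hi') hii
  obtain ⟨wk, hwk, hwkmax⟩ := (aboveExcept r m k).exists_max_image (r k) (Set.toFinite _) (hne m hm k)
  obtain ⟨wj, hwj, hwjmax⟩ := (aboveExcept r m j).exists_max_image (r j) (Set.toFinite _) (hne m hm j)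
  have hdisj {w} (h1 : w ∈ aboveExcept r m k) (h2 : w ∈ aboveExcept r m j) : False := by
    rw [mem_aboveExcept] at h1 h2
    obtain ⟨i, hi⟩ := hD w
    refine not_lt.2 (hi _ (hmem i)) ?_
    by_cases hik : i = k
    · exact h2 i (hik ▸ hjk.symm)
    · exact h1 i hik
  rw [Set.ncard_eq_two]
  refine ⟨wk, wj, fun h ↦ hdisj hwk (h ▸ hwj), Set.ext fun w ↦ ?_⟩
  simp only [Set.mem_ofPred_eq, Set.mem_insert_iff, Set.mem_singleton_iff]
  constructor
  · rintro ⟨hwD, hw⟩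
    by_cases h1 : w ∈ aboveExcept r m k
    · exact Or.inl (hr k (le_antisymm (hwkmax w h1) (hw.isMax_of_insert hmem wk hwk)))
    by_cases h2 : w ∈ aboveExcept r m j
    · exact Or.inr (hr j (le_antisymm (hwjmax w h2) (hw.isMax_of_insert hmem wj hwj)))
    exfalso
    -- Every point of `D` stays a minimum after adding `w`.
    have key : ∀ x ∈ D, ∃ a, m a = x ∧ r a (m a) < r a w := by
      intro x hx
      obtain ⟨a, ha⟩ := hw x
      rw [Finset.forall_mem_insert] at ha
      have hax := heq hx ha.2
      refine ⟨a, hax, hax ▸ lt_of_le_of_ne ha.1 fun h ↦ hwD (hr a h ▸ hx)⟩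
    simp only [mem_aboveExcept] at h1 h2
    push Not at h1 h2
    obtain ⟨i, hik, hi⟩ := h1
    obtain ⟨i', hij, hi'⟩ := h2
    obtain ⟨a, ha, ha'⟩ := key _ (hmem i)
    obtain ⟨a', haa, haa'⟩ := key _ (hmem i')
    have hai : a ≠ i := fun h ↦ not_lt.2 hi (h ▸ ha')
    have hai' : a' ≠ i' := fun h ↦ not_lt.2 hi' (h ▸ haa')
    have hak : a = k := by
      by_contra h
      exact hai (hinj hjk hmjk h hik ha)
    have haj' : a' = j := by
      by_contra h
      exact hai' (hinj hjk.symm hmjk.symm h hij haa)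
    subst hak haj'
    have : i = a' := by
      by_contra h
      exact hai (hinj hjk.symm hmjk.symm hjk.symm h ha)
    exact not_lt.2 hi (this ▸ haa')
  · rintro (rfl | rfl)
    · exact hD.insert_of_isMax hm (hsurj' hjk hmjk) hwk hwkmax
    · exact hD.insert_of_isMax hm (hsurj' hjk.symm hmjk.symm) hwj hwjmax

/-- Scarf's lemma with auxiliary vertices: `s i` is the bottom of the `i`-th ranking and lies
above all non-auxiliary vertices in the other rankings. If `s i` has colour `i`, some dominant set
carries every colour exactly once. The proof counts modulo two the pairs `D ⊂ R`, where
`R` is dominant of full size, and `D` has one element fewer and all colours but a fixed one. -/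
lemma exists_dominant_image_eq_univ [Nontrivial I] {r : I → V → α}
    (hr : ∀ i, Function.Injective (r i)) {s : I → V} (hbot : ∀ i y, r i (s i) ≤ r i y)
    (htop : ∀ i k, k ≠ i → ∀ y ∉ Set.range s, r i y < r i (s k))
    (hV : ∃ y, y ∉ Set.range s) {c : V → I} (hc : ∀ i, c (s i) = i) :
    ∃ R : Finset V, Dominant r R ∧ R.card = Fintype.card I ∧ R.image c = Finset.univ := by
  classical
  have := Fintype.ofFinite V
  by_contra! hcon
  obtain ⟨i₀⟩ : Nonempty I := inferInstance
  have hs : Function.Injective s := Function.LeftInverse.injective hc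
  let rooms : Finset (Finset V) := {R | Dominant r R ∧ R.card = Fintype.card I}
  let doors : Finset (Finset V) :=
    {D | Dominant r D ∧ D.card + 1 = Fintype.card I ∧ D.image c = Finset.univ.erase i₀}
  have hdouble := Finset.sum_card_bipartiteAbove_eq_sum_card_bipartiteBelow
    (s := doors) (t := rooms) (fun D R ↦ D ⊆ R)
  have heven : Even (∑ R ∈ rooms, (doors.bipartiteBelow (fun D R ↦ D ⊆ R) R).card) := by
    refine Finset.even_sum _ fun R hR ↦ ?_
    obtain ⟨hRd, hRc⟩ : Dominant r R ∧ R.card = Fintype.card I := by simpa [rooms] using hR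
    have : doors.bipartiteBelow (fun D R ↦ D ⊆ R) R =
        (R.filter fun x ↦ (R.erase x).image c = Finset.univ.erase i₀).image R.erase := by
      ext D
      simp only [Finset.mem_bipartiteBelow, Finset.mem_image, Finset.mem_filter, doors,
        Finset.mem_univ, true_and]
      constructor
      · rintro ⟨⟨-, hDc, hDi⟩, hDR⟩
        obtain ⟨x, hx, rfl⟩ := Finset.exists_eq_insert_iff.2 ⟨hDR, hDc.trans hRc.symm⟩
        exact ⟨x, ⟨Finset.mem_insert_self _ _, by rwa [Finset.erase_insert hx]⟩,
          Finset.erase_insert hx⟩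
      · rintro ⟨x, ⟨hxR, hx⟩, rfl⟩
        exact ⟨⟨hRd.mono (Finset.erase_subset _ _),
          (Finset.card_erase_add_one hxR).trans hRc, hx⟩, Finset.erase_subset _ _⟩
    rw [this, Finset.card_image_of_injOn ((Finset.erase_injOn R).mono
      (by intro x; simp +contextual))]
    exact even_card_erase_of_image_ne_univ hRc (hcon R hRd hRc) i₀
  have hdoor : ∀ D ∈ doors, (rooms.bipartiteAbove (fun D R ↦ D ⊆ R) D).card =
      ({w | w ∉ D ∧ Dominant r (insert w D)} : Set V).ncard := by
    intro D hD
    obtain ⟨hDd, hDc, hDi⟩ : Dominant r D ∧ D.card + 1 = Fintype.card I ∧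
      D.image c = Finset.univ.erase i₀ := by simpa [doors] using hD
    rw [← Set.ncard_coe_finset,
      ← Set.InjOn.ncard_image (f := fun w ↦ insert w D)
        (s := {w | w ∉ D ∧ Dominant r (insert w D)})]
    · congr 1
      ext R
      simp only [Finset.mem_coe, Finset.mem_bipartiteAbove, rooms, Finset.mem_filter,
        Finset.mem_univ, true_and, Set.mem_image, Set.mem_ofPred_eq]
      constructor
      · rintro ⟨⟨hRd, hRc⟩, hDR⟩
        obtain ⟨w, hw, rfl⟩ := Finset.exists_eq_insert_iff.2 ⟨hDR, hDc.trans hRc.symm⟩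
        exact ⟨w, ⟨hw, hRd⟩, rfl⟩
      · rintro ⟨w, ⟨hw, hRd⟩, rfl⟩
        exact ⟨⟨hRd, by rw [Finset.card_insert_of_notMem hw, hDc]⟩, Finset.subset_insert _ _⟩
    · intro w hw w' hw' h
      exact (Finset.insert_inj hw.1).1 h
  -- The only set that extends in just one way consists of the auxiliary vertices except `s i₀`.
  let D₀ : Finset V := (Finset.univ.erase i₀).image s
  have hext : ({w | w ∉ D₀ ∧ Dominant r (insert w D₀)} : Set V).ncard = 1 := by
    obtain ⟨w₀, hw₀, hmax⟩ := (Finset.univ.filter fun y ↦ y ∉ Set.range s).exists_max_image (r i₀)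
      (by simpa [Finset.Nonempty] using hV)
    simp only [Finset.mem_filter, Finset.mem_univ, true_and] at hw₀ hmax
    rw [Set.ncard_eq_one]
    refine ⟨w₀, Set.ext fun w ↦ ?_⟩
    simp only [Set.mem_ofPred_eq, Set.mem_singleton_iff]
    have hlt {y} (hy : y ∉ Set.range s) (i) : r i (s i) < r i y :=
      lt_of_le_of_ne (hbot i y) fun h ↦ hy ⟨i, hr i h⟩
    have hmemD {i} (hi : i ≠ i₀) : s i ∈ D₀ :=
      Finset.mem_image_of_mem s (by simpa using hi)
    constructor
    · rintro ⟨hwD, hw⟩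
      have h₀ {y} (hy : y ∉ Set.range s) : r i₀ y ≤ r i₀ w := by
        obtain ⟨i, hi⟩ := hw y
        rcases eq_or_ne i i₀ with rfl | hii
        · exact hi w (Finset.mem_insert_self _ _)
        · exact absurd (hi _ (Finset.mem_insert_of_mem (hmemD hii))) (not_le.2 (hlt hy i))
      have hws : w ∉ Set.range s := by
        rintro ⟨l, rfl⟩
        by_cases hl : l = i₀
        · subst hl
          exact not_lt.2 (h₀ hw₀) (hlt hw₀ _)
        · exact hwD (hmemD hl)
      exact hr i₀ (le_antisymm (hmax w hws) (h₀ hw₀))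
    · rintro rfl
      refine ⟨fun h ↦ ?_, fun y ↦ ?_⟩
      · obtain ⟨l, -, rfl⟩ := Finset.mem_image.1 h
        exact hw₀ ⟨l, rfl⟩
      · by_cases hy : y ∈ Set.range s
        · obtain ⟨l, rfl⟩ := hy
          exact ⟨l, fun x _ ↦ hbot l x⟩
        · refine ⟨i₀, (Finset.forall_mem_insert _ _ _).2 ⟨hmax y hy, fun x hx ↦ ?_⟩⟩
          obtain ⟨l, hl, rfl⟩ := Finset.mem_image.1 hx
          exact (htop i₀ l (Finset.ne_of_mem_erase hl) y hy).le
  have hD₀ : D₀ ∈ doors := by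
    obtain ⟨w, hw⟩ := Set.nonempty_of_ncard_ne_zero (hext.trans_ne one_ne_zero)
    simp only [doors, Finset.mem_filter, Finset.mem_univ, true_and]
    refine ⟨hw.2.mono (Finset.subset_insert _ _), ?_, ?_⟩
    · rw [Finset.card_image_of_injective _ hs, Finset.card_erase_add_one (Finset.mem_univ _),
        Finset.card_univ]
    · rw [Finset.image_image, show c ∘ s = id from funext hc, Finset.image_id]
  have hother : ∀ D ∈ doors.erase D₀, (rooms.bipartiteAbove (fun D R ↦ D ⊆ R) D).card = 2 := by
    intro D hD
    obtain ⟨hDne, hD⟩ := Finset.mem_erase.1 hD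
    rw [hdoor D hD]
    obtain ⟨hDd, hDc, hDi⟩ : Dominant r D ∧ D.card + 1 = Fintype.card I ∧
      D.image c = Finset.univ.erase i₀ := by simpa [doors] using hD
    refine hDd.card_insert_eq_two hr hDc fun m hm k ↦ ⟨s k, mem_aboveExcept.2 fun i hik ↦ ?_⟩
    by_cases hmi : m i ∈ Set.range s
    · obtain ⟨l, hl⟩ := hmi
      rcases eq_or_ne l i with rfl | hli
      · rw [← hl]
        exact lt_of_le_of_ne (hbot _ _) fun h ↦ hik (hs (hr _ h))
      · exfalso
        -- Here `s l` is the `r i`-minimum of `D`, so `D` has auxiliary vertices only.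
        have hDs : ∀ x ∈ D, s (c x) = x := by
          intro x hx
          by_cases hxs : x ∈ Set.range s
          · obtain ⟨a, rfl⟩ := hxs
            rw [hc]
          · exact absurd (hl ▸ (hm i).2 x hx) (not_le.2 (htop i l hli x hxs))
        apply hDne
        simp only [D₀]
        rw [← hDi, Finset.image_image]
        ext x
        simp only [Finset.mem_image, Function.comp]
        exact ⟨fun hx ↦ ⟨x, hx, hDs x hx⟩, by rintro ⟨y, hy, rfl⟩; rwa [hDs y hy]⟩
    · exact htop i k hik.symm _ hmi
  rw [← hdouble, ← Finset.add_sum_erase _ _ hD₀, hdoor D₀ hD₀, hext, Finset.sum_congr rfl hother,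
    Finset.sum_const, smul_eq_mul] at heven
  rw [Nat.even_iff] at heven
  omega

end Scarf

/-- Scarf's lemma: given rankings `h i` of a finite set `T` and a colouring of `T` by the indices,
some `σ ⊆ T` admits no point exceeding `σ` simultaneously in all rankings whose index
is a colour occurring in `σ`. -/
theorem exists_finset_dominant_image {T I α : Type*} [Finite T] [Nonempty T] [Fintype I]
    [DecidableEq I] [Nontrivial I] [LinearOrder α] (h : I → T → α) (c : T → I) :
    ∃ σ : Finset T, ∀ y, ∃ i ∈ σ.image c, ∀ x ∈ σ, h i y ≤ h i x := by
  classical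
  have := Fintype.ofFinite T
  obtain ⟨e, he⟩ := Countable.exists_injective_nat (T ⊕ I)
  -- The auxiliary vertices are `Sum.inr i`; ties are broken by the enumeration `e`.
  let g (i : I) : T ⊕ I → WithBot (WithTop α) :=
    Sum.elim (fun t ↦ ((h i t : WithTop α) : WithBot (WithTop α)))
      (fun k ↦ if k = i then ⊥ else ((⊤ : WithTop α) : WithBot (WithTop α)))
  let r (i : I) (v : T ⊕ I) : WithBot (WithTop α) ×ₗ ℕ := toLex (g i v, e v)
  have hlt {i v v'} (hg : g i v < g i v') : r i v < r i v' := Prod.Lex.toLex_lt_toLex.2 (Or.inl hg)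
  have hle {i v v'} (hrr : r i v ≤ r i v') : g i v ≤ g i v' := by
    rcases Prod.Lex.toLex_le_toLex.1 hrr with h | h
    exacts [h.le, h.1.le]
  have hbot (i v) (hv : v ≠ Sum.inr i) : r i (Sum.inr i) < r i v := by
    apply hlt
    rcases v with t | k
    · simp [g]
    · have : k ≠ i := fun h ↦ hv (h ▸ rfl)
      simp [g, this]
  obtain ⟨R, hR, hRc, hRi⟩ := exists_dominant_image_eq_univ (r := r) (s := Sum.inr)
    (c := Sum.elim c id) (fun i v v' hv ↦ he (Prod.ext_iff.1 (toLex.injective hv)).2)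
    (fun i v ↦ by
      rcases eq_or_ne v (Sum.inr i) with rfl | hv
      exacts [le_rfl, (hbot i v hv).le])
    (by
      rintro i k hki (t | k') hy
      · apply hlt
        simpa [g, hki] using WithBot.coe_lt_coe.2 (WithTop.coe_lt_top (h i t))
      · exact absurd ⟨k', rfl⟩ hy)
    ⟨Sum.inl (Classical.arbitrary T), by simp⟩ (fun i ↦ rfl)
  refine ⟨Finset.univ.filter fun t ↦ Sum.inl t ∈ R, fun y ↦ ?_⟩
  obtain ⟨i, hi⟩ := hR (Sum.inl y)
  refine ⟨i, ?_, fun x hx ↦ ?_⟩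
  · obtain ⟨v, hv, hvi⟩ : ∃ v ∈ R, Sum.elim c id v = i := by
      rw [← Finset.mem_image, hRi]
      exact Finset.mem_univ _
    rcases v with t | k
    · exact Finset.mem_image.2 ⟨t, by simpa using hv, hvi⟩
    · obtain rfl : k = i := hvi
      exact absurd (hi _ hv) (not_le.2 (hbot k _ Sum.inl_ne_inr))
  · have := hle (hi (Sum.inl x) (by simpa using hx))
    simpa [g] using this

/-! ### Brouwer's fixed point theorem on the standard simplex -/

/-- Scarf's lemma on the grid of points of `ℕ ^ I` with coordinate sum `N`: the set it provides has
diameter at most `card I`, and its coordinates at the missing colours are at most `card I`. -/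
lemma exists_grid_finset {I : Type*} [Fintype I] [DecidableEq I] [Nontrivial I] (N : ℕ)
    (c : (I → ℕ) → I) :
    ∃ σ : Finset (I → ℕ), σ.Nonempty ∧ (∀ x ∈ σ, ∑ i, x i = N) ∧
      (∀ i, (∃ x ∈ σ, c x = i) ∨ ∀ x ∈ σ, x i ≤ Fintype.card I) ∧
      ∀ x ∈ σ, ∀ x' ∈ σ, ∀ i, x i ≤ x' i + Fintype.card I := by
  let T := {t : I → ℕ // t ∈ Finset.piAntidiag Finset.univ N}
  have hT (t : T) : ∑ i, t.1 i = N := (Finset.mem_piAntidiag.1 t.2).1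
  have : Finite T := inferInstanceAs (Finite (Finset.piAntidiag (Finset.univ : Finset I) N))
  obtain ⟨i₁⟩ : Nonempty I := inferInstance
  have : Nonempty T := ⟨⟨Pi.single i₁ N, by simp⟩⟩
  obtain ⟨σ, hσ⟩ := exists_finset_dominant_image (T := T) (fun i t ↦ t.1 i) (fun t ↦ c t.1)
  set C := σ.image fun t : T ↦ c t.1 with hC
  obtain ⟨j, hj, -⟩ := hσ (Classical.arbitrary T)
  obtain ⟨t₀, ht₀, -⟩ := Finset.mem_image.1 hj
  choose m hm hmle using fun i ↦ σ.exists_min_image (fun t ↦ t.1 i) ⟨t₀, ht₀⟩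
  -- Otherwise some grid point exceeds the minima of `σ` in all coordinates from `C`.
  have hsum : N < ∑ i ∈ C, ((m i).1 i + 1) := by
    by_contra! hle
    let y : I → ℕ := fun i ↦ (if i ∈ C then (m i).1 i + 1 else 0) +
      if i = j then N - ∑ i ∈ C, ((m i).1 i + 1) else 0
    have hy : ∑ i, y i = N := by
      simp only [y, Finset.sum_add_distrib, Finset.sum_ite_eq', Finset.mem_univ, if_true,
        Finset.sum_ite_mem, Finset.univ_inter]
      simp only [Finset.sum_add_distrib] at hle
      omega
    obtain ⟨i, hi, hiy⟩ := hσ ⟨y, by simpa using hy⟩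
    have := hiy (m i) (hm i)
    simp only [y, hi, if_true] at this
    omega
  rw [Finset.sum_add_distrib, Finset.sum_const, smul_eq_mul, mul_one] at hsum
  have hCcard : C.card ≤ Fintype.card I := Finset.card_le_univ C
  have hsplit (t : T) : ∑ i ∈ C, t.1 i + ∑ i ∈ Cᶜ, t.1 i = N := by
    rw [Finset.sum_add_sum_compl, hT]
  have hmin (t) (ht : t ∈ σ) : ∑ i ∈ C, (m i).1 i ≤ ∑ i ∈ C, t.1 i :=
    Finset.sum_le_sum fun i _ ↦ hmle i t ht
  have hout (t) (ht : t ∈ σ) (i) (hi : i ∉ C) : t.1 i ≤ Fintype.card I := by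
    have h1 := Finset.single_le_sum (f := t.1) (fun i _ ↦ Nat.zero_le _) (Finset.mem_compl.2 hi)
    have := hsplit t
    have := hmin t ht
    omega
  have hin (t) (ht : t ∈ σ) (i) (hi : i ∈ C) : t.1 i ≤ (m i).1 i + Fintype.card I := by
    have h1 := Finset.sum_le_sum (s := C.erase i) fun k _ ↦ hmle k t ht
    have h2 := Finset.add_sum_erase C (fun k ↦ (m k).1 k) hi
    have h3 := Finset.add_sum_erase C t.1 hi
    have := hsplit t
    omega
  refine ⟨σ.image Subtype.val, ⟨t₀.1, Finset.mem_image_of_mem _ ht₀⟩, ?_, fun i ↦ ?_, ?_⟩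
  · simp only [Finset.forall_mem_image]
    exact fun t _ ↦ hT t
  · by_cases hi : i ∈ C
    · obtain ⟨t, ht, rfl⟩ := Finset.mem_image.1 hi
      exact Or.inl ⟨t.1, Finset.mem_image_of_mem _ ht, rfl⟩
    · refine Or.inr ?_
      simp only [Finset.forall_mem_image]
      exact fun t ht ↦ hout t ht i hi
  · simp only [Finset.forall_mem_image]
    intro t ht t' ht' i
    by_cases hi : i ∈ C
    · exact (hin t ht i hi).trans (by have := hmle i t' ht'; omega)
    · exact (hout t ht i hi).trans (by omega)

/-- For a self-map `f` of the simplex, colour `x` by an index `i` with `x i ≤ f x i`. The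
set found in a fine grid then consists of points that `f` nearly increases in every coordinate,
and as coordinate sums are preserved, `f` nearly fixes them. -/
lemma exists_dist_lt_stdSimplex {I : Type*} [Fintype I] [Nontrivial I]
    (f : stdSimplex ℝ I → stdSimplex ℝ I) (hf : Continuous f) {ε : ℝ} (hε : 0 < ε) :
    ∃ x, dist (f x) x < ε := by
  classical
  set n : ℝ := (Fintype.card I : ℝ) with hn
  have hn0 : 0 < n := by simp [hn, Fintype.card_pos]
  have hsum (x : stdSimplex ℝ I) : ∑ i, x i = 1 := x.2.2
  have hnonneg (x : stdSimplex ℝ I) (i : I) : 0 ≤ x i := x.2.1 i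
  have hcol (x : stdSimplex ℝ I) : ∃ i, x i ≤ f x i := by
    obtain ⟨i, -, hi⟩ := Finset.exists_le_of_sum_le (s := Finset.univ) Finset.univ_nonempty
      (f := fun i ↦ x i) (g := fun i ↦ f x i) (by rw [hsum, hsum])
    exact ⟨i, hi⟩
  choose col hcol using hcol
  -- The constant is chosen so that `n` coordinate errors of size `3 * η` stay below `ε`.
  set η := ε / (4 * n) with hη
  have hη0 : 0 < η := by positivity
  obtain ⟨δ, hδ0, hδ⟩ := Metric.uniformContinuous_iff.1
    (CompactSpace.uniformContinuous_of_continuous hf) η hη0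
  obtain ⟨N, hN⟩ := exists_nat_gt (max (n / δ) (n / η))
  have hN0 : (0 : ℝ) < N := lt_of_le_of_lt (by positivity) hN
  have hNδ : n / N < δ := by
    rw [div_lt_iff₀ hN0, mul_comm, ← div_lt_iff₀ hδ0]
    exact (le_max_left _ _).trans_lt hN
  have hNη : n / N < η := by
    rw [div_lt_iff₀ hN0, mul_comm, ← div_lt_iff₀ hη0]
    exact (le_max_right _ _).trans_lt hN
  obtain ⟨i₁⟩ : Nonempty I := inferInstance
  let p (t : I → ℕ) (ht : ∑ i, t i = N) : stdSimplex ℝ I :=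
    ⟨fun i ↦ t i / N, fun i ↦ by positivity, by
      rw [← Finset.sum_div, ← Nat.cast_sum, ht, div_self hN0.ne']⟩
  obtain ⟨σ, ⟨t₀, ht₀⟩, hσN, hσc, hσd⟩ := exists_grid_finset N
    (fun t ↦ if ht : ∑ i, t i = N then col (p t ht) else i₁)
  have hdist {t t'} (ht : t ∈ σ) (ht' : t' ∈ σ) (i) :
      p t (hσN t ht) i - p t' (hσN t' ht') i ≤ n / N := by
    change (t i : ℝ) / N - t' i / N ≤ n / N
    rw [← sub_div]
    gcongr
    rw [sub_le_iff_le_add', hn]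
    exact_mod_cast hσd t ht t' ht' i
  set x := p t₀ (hσN t₀ ht₀) with hx
  have hclose (t) (ht : t ∈ σ) (i) : f (p t (hσN t ht)) i ≤ f x i + η := by
    have h1 : dist (p t (hσN t ht)) x < δ := by
      refine lt_of_le_of_lt ?_ hNδ
      rw [Subtype.dist_eq, dist_pi_le_iff (by positivity)]
      intro i
      change |p t (hσN t ht) i - x i| ≤ n / N
      rw [abs_le]
      exact ⟨by linarith [hdist ht₀ ht i], hdist ht ht₀ i⟩
    have h2 := (dist_le_pi_dist (f (p t (hσN t ht))).1 (f x).1 i).trans (hδ h1).le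
    rw [Real.dist_eq] at h2
    have := (abs_le.1 h2).2
    change (f (p t (hσN t ht))).1 i ≤ (f x).1 i + η
    linarith
  have hlow (i) : x i ≤ f x i + 3 * η := by
    rcases hσc i with ⟨t, ht, hti⟩ | h
    · rw [dif_pos (hσN t ht)] at hti
      have h1 := hcol (p t (hσN t ht))
      rw [hti] at h1
      linarith [hclose t ht i, hdist ht₀ ht i]
    · have h1 : x i ≤ n / N := by
        change (t₀ i : ℝ) / N ≤ n / N
        gcongr
        rw [hn]
        exact_mod_cast h t₀ ht₀
      linarith [hnonneg (f x) i]
  refine ⟨x, ?_⟩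
  have h3 : n * (3 * η) < ε := by
    rw [hη]
    field_simp
    norm_num
  rw [Subtype.dist_eq, dist_pi_lt_iff hε]
  intro i
  have h4 : f x i - x i + ∑ k ∈ Finset.univ.erase i, (f x k - x k) = 0 := by
    rw [Finset.add_sum_erase _ (fun k ↦ f x k - x k) (Finset.mem_univ i), Finset.sum_sub_distrib,
      hsum, hsum, sub_self]
  have h5 : (Finset.univ.erase i).card • (-(3 * η)) ≤
      ∑ k ∈ Finset.univ.erase i, (f x k - x k) :=
    Finset.card_nsmul_le_sum _ _ _ fun k _ ↦ by linarith [hlow k]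
  have h6 : ((Finset.univ.erase i).card : ℝ) + 1 = n := by
    rw [hn, ← Finset.card_univ]
    exact_mod_cast Finset.card_erase_add_one (Finset.mem_univ i)
  rw [nsmul_eq_mul] at h5
  have h7 := hlow i
  have h8 : 0 ≤ ((Finset.univ.erase i).card : ℝ) * η := by positivity
  change dist (f x i) (x i) < ε
  rw [Real.dist_eq, abs_lt]
  constructor <;> nlinarith

/-- A continuous self-map of a compact space that moves points by arbitrarily small amounts has a
fixed point. -/
lemma exists_eq_of_forall_exists_dist_lt {X : Type*} [MetricSpace X] [CompactSpace X] {f : X → X}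
    (hf : Continuous f) (h : ∀ ε > 0, ∃ x, dist (f x) x < ε) : ∃ x, f x = x := by
  obtain ⟨x₁, -⟩ := h 1 one_pos
  have : Nonempty X := ⟨x₁⟩
  obtain ⟨x, -, hx⟩ := isCompact_univ.exists_isMinOn Set.univ_nonempty
    (hf.dist continuous_id).continuousOn
  refine ⟨x, dist_le_zero.1 (not_lt.1 fun hpos ↦ ?_)⟩
  obtain ⟨y, hy⟩ := h _ hpos
  exact not_lt.2 (hx (Set.mem_univ y)) hy

/-- Brouwer's fixed point theorem for the standard simplex. -/
theorem exists_fixedPoint_stdSimplex {I : Type*} [Fintype I] [Nonempty I]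
    (f : stdSimplex ℝ I → stdSimplex ℝ I) (hf : Continuous f) : ∃ x, f x = x := by
  classical
  cases subsingleton_or_nontrivial I
  · have x : stdSimplex ℝ I := ⟨_, single_mem_stdSimplex ℝ (Classical.arbitrary I)⟩
    refine ⟨x, Subtype.ext (funext fun i ↦ ?_)⟩
    have (y : stdSimplex ℝ I) : y.1 i = 1 := by
      rw [← y.2.2, Fintype.sum_subsingleton _ i]
    rw [this, this]
  · exact exists_eq_of_forall_exists_dist_lt hf fun ε hε ↦ exists_dist_lt_stdSimplex f hf hε

/-! ### Approximation by finite-dimensional simplices -/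

/-- The Schauder projection: a compact convex set maps continuously to a finite-dimensional
simplex, and back by barycentric coordinates, moving each point by less than `ε`. -/
lemma exists_schauder_projection {G : Type*} [NormedAddCommGroup G] [NormedSpace ℝ G] {X : Set G}
    (hcompact : IsCompact X) (hconvex : Convex ℝ X) (hne : X.Nonempty) {ε : ℝ} (hε : 0 < ε) :
    ∃ (t : Finset G) (_ : Nonempty t) (φ : X → stdSimplex ℝ t) (b : stdSimplex ℝ t → X),
      Continuous φ ∧ Continuous b ∧ ∀ y, dist (b (φ y)) y < ε := by
  obtain ⟨t, htX, htfin, hcov⟩ := hcompact.finite_cover_balls hε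
  lift t to Finset G using htfin
  have htne : Nonempty t := by
    obtain ⟨y, hy⟩ := hne
    obtain ⟨x, hx, -⟩ := Set.mem_iUnion₂.1 (hcov hy)
    exact ⟨⟨x, hx⟩⟩
  let g (x : t) (y : X) : ℝ := max 0 (ε - dist (y : G) x)
  have hg0 (x y) : 0 ≤ g x y := le_max_left _ _
  have hgc (x) : Continuous (g x) := by fun_prop
  have hS (y : X) : 0 < ∑ x, g x y := by
    obtain ⟨x, hx, hxy⟩ := Set.mem_iUnion₂.1 (hcov y.2)
    refine Finset.sum_pos' (fun x _ ↦ hg0 x y) ⟨⟨x, hx⟩, Finset.mem_univ _, ?_⟩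
    exact lt_max_of_lt_right (sub_pos.2 hxy)
  have hφ1 (y : X) : ∑ x, g x y / ∑ x', g x' y = 1 := by
    rw [← Finset.sum_div, div_self (hS y).ne']
  refine ⟨t, htne, fun y ↦ ⟨fun x ↦ g x y / ∑ x', g x' y,
      fun x ↦ div_nonneg (hg0 x y) (hS y).le, hφ1 y⟩,
    fun w ↦ ⟨∑ x : t, w.1 x • (x : G), hconvex.sum_mem (fun x _ ↦ w.2.1 x) w.2.2
      fun x _ ↦ htX x.2⟩, ?_, ?_, fun y ↦ ?_⟩
  · refine Continuous.subtype_mk (continuous_pi fun x ↦ ?_) _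
    exact (hgc x).div (continuous_finsetSum _ fun x _ ↦ hgc x) fun y ↦ (hS y).ne'
  · refine Continuous.subtype_mk (continuous_finsetSum _ fun x _ ↦ ?_) _
    exact ((continuous_apply x).comp continuous_subtype_val).smul continuous_const
  · -- Only points of the net closer than `ε` to `y` have positive weight.
    have hterm (x : t) : g x y * dist (y : G) x ≤ g x y * ε ∧
        (0 < g x y → g x y * dist (y : G) x < g x y * ε) := by
      by_cases h : 0 < g x y
      · have : dist (y : G) x < ε := by
          rcases lt_max_iff.1 h with h | h
          exacts [absurd h (lt_irrefl _), sub_pos.1 h]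
        have := mul_lt_mul_of_pos_left this h
        exact ⟨this.le, fun _ ↦ this⟩
      · have : g x y = 0 := le_antisymm (not_lt.1 h) (hg0 x y)
        simp [this]
    have hlt : ∑ x, g x y * dist (y : G) x < (∑ x, g x y) * ε := by
      rw [Finset.sum_mul]
      obtain ⟨x, -, hx⟩ := (Finset.sum_pos_iff_of_nonneg fun x _ ↦ hg0 x y).1 (hS y)
      exact Finset.sum_lt_sum (fun x _ ↦ (hterm x).1) ⟨x, Finset.mem_univ _, (hterm x).2 hx⟩
    rw [Subtype.dist_eq, dist_eq_norm]
    calc ‖∑ x : t, (g x y / ∑ x', g x' y) • (x : G) - (y : G)‖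
        = ‖∑ x : t, (g x y / ∑ x', g x' y) • ((x : G) - y)‖ := by
          simp only [smul_sub, Finset.sum_sub_distrib, ← Finset.sum_smul, hφ1, one_smul]
      _ ≤ ∑ x : t, g x y / (∑ x', g x' y) * dist (y : G) x := by
          refine (norm_sum_le _ _).trans (Finset.sum_le_sum fun x _ ↦ ?_)
          rw [norm_smul, Real.norm_of_nonneg (div_nonneg (hg0 x y) (hS y).le), dist_comm,
            dist_eq_norm]
      _ = (∑ x : t, g x y * dist (y : G) x) / ∑ x', g x' y := by
          rw [Finset.sum_div]
          exact Finset.sum_congr rfl fun x _ ↦ by ring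
      _ < ε := by
          rw [div_lt_iff₀ (hS y), mul_comm]
          exact hlt

theorem mainTheorem2 {G : Type*} [NormedAddCommGroup G] [NormedSpace ℝ G] (X : Set G)
    (hcompact : IsCompact X) (hconvex : Convex ℝ X)
    (hinf : ¬ FiniteDimensional ℝ (vectorSpan ℝ X))
    (f : X → X) (hf : Continuous f) :
    ∃ x : X, f x = x := by
  have hne : X.Nonempty := by
    rw [Set.nonempty_iff_ne_empty]
    rintro rfl
    apply hinf
    rw [vectorSpan_empty]
    infer_instance
  have : CompactSpace X := isCompact_iff_compactSpace.1 hcompact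
  refine exists_eq_of_forall_exists_dist_lt hf fun ε hε ↦ ?_
  obtain ⟨t, _, φ, b, hφ, hb, hbφ⟩ := exists_schauder_projection hcompact hconvex hne hε
  obtain ⟨w, hw⟩ := exists_fixedPoint_stdSimplex (fun w ↦ φ (f (b w))) (hφ.comp (hf.comp hb))
  -- The point `x = b w` satisfies `b (φ (f x)) = x`, so `f x` is close to `x`.
  refine ⟨b w, ?_⟩
  have := hbφ (f (b w))
  rwa [hw, dist_comm] at this
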